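/- All graphs are finite and simple. A graph is $2$-connected if it has at least three vertices, is connected, and remains connected after the removal of any one vertex; it is minimally $2$-connected if it is $2$-connected and deleting any edge leaves a graph that is not $2$-connected. For a graph $G$ with adjacency matrix $A(G)$ and diagonal degree matrix $D(G)$, let $\rho_\alpha(G)$ be the largest eigenvalue of $A_\alpha(G)=\alpha D(G)+(1-\alpha)A(G)$. Let $K_{2,k}$ be the complete bipartite graph with parts of sizes $2$ and $k$, and for $k\ge 1$ let $SK_{2,k}$ be the graph obtained from $K_{2,k}$ by subdividing one edge. **Theorem.** Let $G$ be a minimally $2$-connected graph with $m$ edges and let $\alpha\in[\frac12,1)$. (i) If $m\ge 6$ is even, then $\rho_\alpha(G)\le\rho_\alpha(K_{2,m/2})$, with equality if and only if $G\cong K_{2,m/2}$. (ii) If $m\ge 9$ is odd, then $\rho_\alpha(G)\le\rho_\alpha(SK_{2,(m-1)/2})$, where $\rho_\alpha(SK_{2,(m-1)/2})$ is the largest root of $$x^3-\Bigl(\tfrac{m+5}{2}\alpha+1\Bigr)x^2+\Bigl(\tfrac{m+5}{2}\alpha^2+\tfrac{5(m-1)}{2}\alpha+2-m\Bigr)x-2m\alpha^2-(m-5)\alpha+m-3=0,$$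 with equality if and only if $G\cong SK_{2,(m-1)/2}$. -/

import Mathlib

namespace AlphaIndex

variable {V : Type*}

/-- A finite graph is `k`-connected if it has more than `k` vertices and removing fewer than `k`
vertices always leaves a connected graph. -/
def IsKConnected [Fintype V] (k : ℕ) (G : SimpleGraph V) : Prop :=
  k < Fintype.card V ∧
    ∀ S : Finset V, S.card < k → (G.induce {v : V | v ∉ S}).Connected

/-- A graph is minimally `k`-connected if it is `k`-connected and deleting any edge leaves a graph
which is not `k`-connected. -/
def IsMinimallyKConnected [Fintype V] (k : ℕ) (G : SimpleGraph V) : Prop :=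
  IsKConnected k G ∧ ∀ e ∈ G.edgeSet, ¬ IsKConnected k (G.deleteEdges {e})

open Classical in
/-- The matrix `A_α(G) = α D(G) + (1 - α) A(G)`. -/
noncomputable def alphaMatrix [Fintype V] (α : ℝ) (G : SimpleGraph V) : Matrix V V ℝ :=
  α • G.degMatrix ℝ + (1 - α) • G.adjMatrix ℝ

open Classical in
/-- The set of (real) eigenvalues of `A_α(G)`. -/
def alphaEigenvalues [Fintype V] (α : ℝ) (G : SimpleGraph V) : Set ℝ :=
  {μ : ℝ | Module.End.HasEigenvalue (Matrix.toLin' (alphaMatrix α G)) μ}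

/-- The `α`-index `ρ_α(G)`: the largest eigenvalue of `A_α(G)`. The supremum is attained as soon as
`G` has a vertex, see `isGreatest_alphaIndex`. -/
noncomputable def alphaIndex [Fintype V] (α : ℝ) (G : SimpleGraph V) : ℝ :=
  sSup (alphaEigenvalues α G)

theorem alphaMatrix_isHermitian [Fintype V] (α : ℝ) (G : SimpleGraph V) :
    (alphaMatrix α G).IsHermitian := by
  classical
  ext i j
  by_cases h : i = j
  · subst h; simp [Matrix.conjTranspose_apply]
  · have h2 : j ≠ i := fun h' => h h'.symm
    simp [alphaMatrix, SimpleGraph.degMatrix, Matrix.conjTranspose_apply,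
      SimpleGraph.adjMatrix_apply, SimpleGraph.adj_comm, h, h2]

theorem isGreatest_alphaIndex [Fintype V] [Nonempty V] (α : ℝ) (G : SimpleGraph V) :
    IsGreatest (alphaEigenvalues α G) (alphaIndex α G) := by
  classical
  have hfin : (alphaEigenvalues α G).Finite := Module.End.finite_hasEigenvalue _
  have hne : (alphaEigenvalues α G).Nonempty := by
    have hA := alphaMatrix_isHermitian α G
    obtain ⟨i⟩ := ‹Nonempty V›
    refine ⟨hA.eigenvalues i, ?_⟩
    have hmem := hA.eigenvalues_mem_spectrum_real i
    rw [← Matrix.spectrum_toLin'] at hmem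
    have hev := Module.End.hasEigenvalue_iff_mem_spectrum.mpr hmem
    unfold alphaEigenvalues
    convert hev
  exact ⟨hne.csSup_mem hfin, fun x hx => le_csSup hfin.bddAbove hx⟩

/-- The graph obtained from `G` by subdividing its edge `e`: the edge `e` is removed, and the new
vertex `none` is joined to the two ends of `e`. -/
def subdivideEdge (G : SimpleGraph V) (e : Sym2 V) : SimpleGraph (Option V) where
  Adj
    | some x, some y => G.Adj x y ∧ s(x, y) ≠ e
    | some x, none => x ∈ e
    | none, some y => y ∈ e
    | none, none => False
  symm := ⟨by
    rintro (_ | x) (_ | y) h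
    · exact h
    · exact h
    · exact h
    · exact ⟨h.1.symm, by rw [Sym2.eq_swap]; exact h.2⟩⟩
  loopless := ⟨by
    rintro (_ | x) h
    · exact h
    · exact G.loopless.irrefl x h.1⟩

/-- The complete bipartite graph `K_{2,k}`. -/
abbrev K2 (k : ℕ) : SimpleGraph (Fin 2 ⊕ Fin k) :=
  completeBipartiteGraph (Fin 2) (Fin k)

/-- The graph `SK_{2,k}` (for `k ≥ 1`): `K_{2,k}` with one edge subdivided. -/
def SK2 (k : ℕ) (hk : 0 < k) : SimpleGraph (Option (Fin 2 ⊕ Fin k)) :=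
  subdivideEdge (K2 k) s(Sum.inl 0, Sum.inr ⟨0, hk⟩)

/-- The cubic polynomial function whose largest root is `ρ_α(SK_{2,(m-1)/2})`. -/
noncomputable def skCubic (m : ℕ) (α x : ℝ) : ℝ :=
  x ^ 3 - (((m : ℝ) + 5) / 2 * α + 1) * x ^ 2
    + (((m : ℝ) + 5) / 2 * α ^ 2 + 5 * ((m : ℝ) - 1) / 2 * α + 2 - (m : ℝ)) * x
    - 2 * (m : ℝ) * α ^ 2 - ((m : ℝ) - 5) * α + (m : ℝ) - 3

end AlphaIndex

/-!
The index `ρ_α(G)` is bounded above by test vectors: `A_α(G)` is nonnegative, so if `y > 0` and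
`A_α(G) y < l y` in every entry, then `ρ_α(G) < l` (`alphaIndex_lt_of_forall_lt`), and a positive
eigenvector belongs to `ρ_α(G)` (`alphaIndex_eq_of_forall_eq`). The latter yields the indices of
`K_{2,k}` and `SK_{2,k}` as roots of a quadratic and of the cubic.

Take the vector of degrees as test vector. If all degrees are at most `K` and the degrees of the
neighbours of any vertex add up to at most `M`, the result is `ρ_α(G) ≤ α K + (1 - α) M / K`, for
`α ≥ 1/2`. In a minimally `2`-connected graph with at least four vertices there are no triangles,
so the neighbours of `u` are incident with pairwise different edges, and `M = m` is possible. As all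
degrees are at least two, `d(u) ≤ m / 2`. Write `k = ⌊m / 2⌋`. If no vertex has degree `k`, the
bound with `K = k - 1` and `M = 2 k`, or `M = 4` for `k = 3`, is below the index of the extremal
graph (`IsMinimallyKConnected.alphaIndex_lt`). It remains to justify `M = 2 k` for odd `m`, and to
treat a vertex `u` of degree `k`.

If every edge meets the neighbourhood of a vertex `u` of degree at least three, then the graph is
`K_{2,d(u)}` (`IsMinimallyKConnected.nonempty_iso_K2`). This settles even `m`, and for odd `m` it
improves `M = m` to `M = m - 1 = 2 k` (at a vertex of degree two the sum is at most `2 K`). A vertex `u` of degree `k` then has only neighbours of degree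
two, and exactly one edge `w₁ w₂` misses them (`IsMinimallyKConnected.exists_isThetaFan`): `u` is
joined by `a` paths of length two to `w₁` and by `b` such paths to `w₂`, where `a + b = k`. For
`a = 1` or `b = 1` this is `SK_{2,k}`, and for `a, b ≥ 2` a test vector constant on the vertices of
degree two shows that the index is smaller (`IsThetaFan.alphaIndex_lt`).

Both structural facts, triangle-freeness and the recognition of `K_{2,k}`, rest on the same
observation: each edge `x y` together with some vertex `c` separates the graph (`IsMixedCut`), and
the cuts of two edges cross in sets with a single vertex of attachment, which are empty.
-/

namespace AlphaIndex

open scoped Classical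
open Finset Matrix

/-! ### Eigenvalues of `A_α(G)` and test vectors -/

theorem alphaMatrix_mulVec {V : Type*} [Fintype V] (α : ℝ) (G : SimpleGraph V) (z : V → ℝ) (v : V) :
    (alphaMatrix α G *ᵥ z) v = ∑ w with G.Adj v w, (α * z v + (1 - α) * z w) := by
  have h : ∀ w, alphaMatrix α G v w * z w
      = (if v = w then α * G.degree v * z w else 0) + if G.Adj v w then (1 - α) * z w else 0 := by
    intro w
    by_cases hvw : v = w
    · subst hvw
      simp [alphaMatrix, SimpleGraph.degMatrix, SimpleGraph.adjMatrix_apply]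
    · by_cases ha : G.Adj v w <;>
        simp [alphaMatrix, SimpleGraph.degMatrix, SimpleGraph.adjMatrix_apply, hvw, ha]
  simp only [mulVec, dotProduct, h, Finset.sum_add_distrib, Finset.sum_ite_eq, Finset.mem_univ,
    if_true, Finset.sum_const, nsmul_eq_mul, Finset.sum_filter]
  rw [← G.card_neighborFinset_eq_degree, SimpleGraph.neighborFinset_eq_filter]
  simp only [mul_comm, mul_left_comm, Finset.sum_ite, Finset.sum_const, nsmul_eq_mul]
  ring_nf

theorem mem_alphaEigenvalues {V : Type*} [Fintype V] {α : ℝ} {G : SimpleGraph V} {μ : ℝ} :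
    μ ∈ alphaEigenvalues α G ↔ ∃ z : V → ℝ, z ≠ 0 ∧
      ∀ v, ∑ w with G.Adj v w, (α * z v + (1 - α) * z w) = μ * z v := by
  have h : μ ∈ alphaEigenvalues α G ↔ ∃ z : V → ℝ, z ≠ 0 ∧ alphaMatrix α G *ᵥ z = μ • z := by
    constructor
    · intro h
      obtain ⟨z, hz⟩ := Module.End.HasEigenvalue.exists_hasEigenvector h
      refine ⟨z, hz.2, ?_⟩
      have := hz.apply_eq_smul
      rwa [Matrix.toLin'_apply] at this
    · rintro ⟨z, hz, h⟩
      refine Module.End.hasEigenvalue_of_hasEigenvector (x := z) ⟨?_, hz⟩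
      rw [Module.End.mem_eigenspace_iff, Matrix.toLin'_apply]
      exact h
  simp only [h, funext_iff, alphaMatrix_mulVec, Pi.smul_apply, smul_eq_mul]

/-- Collatz–Wielandt: a positive vector bounds every eigenvalue of the nonnegative matrix `A_α(G)`
from above. -/
theorem exists_mul_le_of_mem_alphaEigenvalues {V : Type*} [Fintype V] {α : ℝ} (h0 : 0 ≤ α)
    (h1 : α ≤ 1) {G : SimpleGraph V} {μ : ℝ} (hμ : μ ∈ alphaEigenvalues α G) {y : V → ℝ}
    (hy : ∀ v, 0 < y v) :
    ∃ v, μ * y v ≤ ∑ w with G.Adj v w, (α * y v + (1 - α) * y w) := by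
  obtain ⟨z, hz, hz'⟩ := mem_alphaEigenvalues.1 hμ
  obtain ⟨v₀, hv₀⟩ := Function.ne_iff.1 hz
  obtain ⟨v, -, hv⟩ := Finset.exists_max_image univ (fun v => |z v| / y v) ⟨v₀, mem_univ _⟩
  -- at a vertex where `|z v| / y v` is largest, the eigenvalue equation for `z` compares with `y`
  set c := |z v| / y v with hc
  have hcpos : 0 < c :=
    lt_of_lt_of_le (div_pos (abs_pos.2 hv₀) (hy v₀)) (hv v₀ (mem_univ _))
  have hle : ∀ w, |z w| ≤ c * y w := fun w => (div_le_iff₀ (hy w)).1 (hv w (mem_univ _))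
  have heq : |z v| = c * y v := by rw [hc, div_mul_cancel₀ _ (hy v).ne']
  refine ⟨v, ?_⟩
  have key : c * (μ * y v) ≤ c * ∑ w with G.Adj v w, (α * y v + (1 - α) * y w) := by
    calc c * (μ * y v) = μ * |z v| := by rw [heq]; ring
      _ ≤ |μ * z v| := by
        rw [abs_mul]; exact mul_le_mul_of_nonneg_right (le_abs_self _) (abs_nonneg _)
      _ = |∑ w with G.Adj v w, (α * z v + (1 - α) * z w)| := by rw [hz']
      _ ≤ ∑ w with G.Adj v w, |α * z v + (1 - α) * z w| := Finset.abs_sum_le_sum_abs _ _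
      _ ≤ ∑ w with G.Adj v w, c * (α * y v + (1 - α) * y w) := by
        refine Finset.sum_le_sum fun w _ => ?_
        calc |α * z v + (1 - α) * z w| ≤ |α * z v| + |(1 - α) * z w| := abs_add_le _ _
          _ = α * |z v| + (1 - α) * |z w| := by
            rw [abs_mul, abs_mul, abs_of_nonneg h0, abs_of_nonneg (sub_nonneg.2 h1)]
          _ ≤ α * (c * y v) + (1 - α) * (c * y w) :=
            add_le_add (mul_le_mul_of_nonneg_left (hle v) h0)
              (mul_le_mul_of_nonneg_left (hle w) (sub_nonneg.2 h1))
          _ = c * (α * y v + (1 - α) * y w) := by ring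
      _ = _ := by rw [Finset.mul_sum]
  exact le_of_mul_le_mul_left key hcpos

theorem alphaIndex_lt_of_forall_lt {V : Type*} [Fintype V] [Nonempty V] {α : ℝ} (h0 : 0 ≤ α)
    (h1 : α ≤ 1) {G : SimpleGraph V} {l : ℝ} {y : V → ℝ} (hy : ∀ v, 0 < y v)
    (h : ∀ v, ∑ w with G.Adj v w, (α * y v + (1 - α) * y w) < l * y v) :
    alphaIndex α G < l := by
  obtain ⟨v, hv⟩ := exists_mul_le_of_mem_alphaEigenvalues h0 h1 (isGreatest_alphaIndex α G).1 hy
  exact lt_of_mul_lt_mul_right (hv.trans_lt (h v)) (hy v).le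

/-- A positive eigenvector belongs to the largest eigenvalue. -/
theorem alphaIndex_eq_of_forall_eq {V : Type*} [Fintype V] [Nonempty V] {α : ℝ} (h0 : 0 ≤ α)
    (h1 : α ≤ 1) {G : SimpleGraph V} {l : ℝ} {y : V → ℝ} (hy : ∀ v, 0 < y v)
    (h : ∀ v, ∑ w with G.Adj v w, (α * y v + (1 - α) * y w) = l * y v) :
    alphaIndex α G = l := by
  refine le_antisymm ?_ ((isGreatest_alphaIndex α G).2 (mem_alphaEigenvalues.2 ⟨y, ?_, h⟩))
  · obtain ⟨v, hv⟩ := exists_mul_le_of_mem_alphaEigenvalues h0 h1 (isGreatest_alphaIndex α G).1 hy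
    exact le_of_mul_le_mul_right (hv.trans (h v).le) (hy v)
  · obtain ⟨v⟩ := ‹Nonempty V›
    exact fun hz => (hy v).ne' (congrFun hz v)

theorem alphaEigenvalues_subset_of_iso {V W : Type*} [Fintype V] [Fintype W] (α : ℝ)
    {G : SimpleGraph V} {H : SimpleGraph W} (f : G ≃g H) :
    alphaEigenvalues α H ⊆ alphaEigenvalues α G := by
  intro μ hμ
  obtain ⟨z, hz, h⟩ := mem_alphaEigenvalues.1 hμ
  refine mem_alphaEigenvalues.2 ⟨z ∘ f, fun h0 => hz ?_, fun v => ?_⟩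
  · funext w
    simpa using congrFun h0 (f.symm w)
  · rw [Function.comp_apply, ← h (f v)]
    refine Finset.sum_equiv f.toEquiv (fun w => ?_) (fun w _ => rfl)
    simpa using f.map_adj_iff.symm

theorem alphaIndex_congr {V W : Type*} [Fintype V] [Fintype W] (α : ℝ)
    {G : SimpleGraph V} {H : SimpleGraph W} (f : G ≃g H) : alphaIndex α G = alphaIndex α H :=
  congrArg sSup ((alphaEigenvalues_subset_of_iso α f.symm).antisymm
    (alphaEigenvalues_subset_of_iso α f))

/-- If all degrees are at most `K` and all neighbourhoods have degree sum at most `M`, then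
`ρ_α(G) < l` as soon as `α K + (1 - α) M / K < l`. The test vector is the degree vector. -/
theorem alphaIndex_lt_of_degree_le {V : Type*} [Fintype V] [Nonempty V] {α : ℝ} (h0 : 1 / 2 ≤ α)
    (h1 : α ≤ 1) {G : SimpleGraph V} {K M : ℕ} (hK : 0 < K) (hpos : ∀ v, 0 < G.degree v)
    (hdeg : ∀ v, G.degree v ≤ K) (hsum : ∀ v, ∑ w with G.Adj v w, G.degree w ≤ M) {l : ℝ}
    (hl : α * K + (1 - α) * (M / K) < l) : alphaIndex α G < l := by
  have hy : ∀ v, 0 < (G.degree v : ℝ) := fun v => by exact_mod_cast hpos v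
  refine alphaIndex_lt_of_forall_lt (by linarith) h1 (y := fun v => (G.degree v : ℝ)) hy fun v => ?_
  have hcard : #{w | G.Adj v w} = G.degree v := by
    rw [← G.card_neighborFinset_eq_degree, SimpleGraph.neighborFinset_eq_filter]
  rw [Finset.sum_add_distrib, Finset.sum_const, hcard, ← Finset.mul_sum, nsmul_eq_mul]
  set S : ℝ := ∑ w with G.Adj v w, (G.degree w : ℝ) with hS
  set d : ℝ := (G.degree v : ℝ) with hd
  have hK' : (0 : ℝ) < K := by exact_mod_cast hK
  have hdK : d ≤ K := by rw [hd]; exact_mod_cast hdeg v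
  have hdpos : 0 < d := hy v
  have hSM : S ≤ M := by rw [hS]; exact_mod_cast hsum v
  have hSK : S ≤ d * K := by
    rw [hS, hd, ← hcard, ← nsmul_eq_mul]
    exact Finset.sum_le_card_nsmul _ _ _ fun w _ => by exact_mod_cast hdeg w
  -- with `S = d s` and `d, s ≤ K`, `(K - d) (K - s) ≥ 0` gives `d + s ≤ K + d s / K ≤ K + M / K`
  have hs : d + S / d ≤ K + M / K := by
    have h2 : S / d ≤ K := by rw [div_le_iff₀ hdpos]; linarith
    have h3 : d * (S / d) = S := by field_simp
    have h4 : (K - d) * (K - S / d) ≥ 0 := mul_nonneg (by linarith) (by linarith)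
    have h5 : (d + S / d) * K ≤ (K + M / K) * K := by
      have : (M : ℝ) / K * K = M := by field_simp
      nlinarith
    exact le_of_mul_le_mul_right h5 hK'
  have h6 : α * d + (1 - α) * (S / d) < l := by nlinarith
  have h7 : d * (α * d) + (1 - α) * S = (α * d + (1 - α) * (S / d)) * d := by field_simp
  rw [h7]
  exact mul_lt_mul_of_pos_right h6 hdpos

/-! ### The indices of the extremal graphs -/

/-- The index of `K_{2,k}` is the larger root of `(x - α k) (x - 2 α) = 2 k (1 - α) ^ 2`. -/
theorem exists_alphaIndex_K2_eq {α : ℝ} (h0 : 1 / 2 ≤ α) (h1 : α < 1) {k : ℕ} (hk : 2 ≤ k) :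
    ∃ l : ℝ, α * k < l ∧ (l - α * k) * (l - 2 * α) = 2 * k * (1 - α) ^ 2 ∧
      alphaIndex α (K2 k) = l := by
  have hk' : (2 : ℝ) ≤ k := by exact_mod_cast hk
  have hb : 0 < 1 - α := by linarith
  obtain ⟨l, ⟨hl1, hl2⟩, hl⟩ : (2 * k * (1 - α) ^ 2 : ℝ) ∈
      (fun x : ℝ => (x - α * k) * (x - 2 * α)) '' Set.Icc (α * k) (α * k + 2 * (1 - α)) := by
    refine intermediate_value_Icc (by linarith) (by fun_prop) ⟨?_, ?_⟩
    · rw [sub_self, zero_mul]; positivity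
    · have : 0 ≤ 2 * (1 - α) * ((2 * α - 1) * (k - 2)) :=
        mul_nonneg (by linarith) (mul_nonneg (by linarith) (by linarith))
      nlinarith
  simp only at hl
  have hne : α * k ≠ l := by
    rintro rfl
    have : 0 < 2 * k * (1 - α) ^ 2 := by positivity
    rw [sub_self, zero_mul] at hl
    linarith
  have hlt : α * k < l := lt_of_le_of_ne hl1 hne
  refine ⟨l, hlt, hl, ?_⟩
  refine alphaIndex_eq_of_forall_eq (by linarith) h1.le
    (y := Sum.elim (fun _ => l - 2 * α) (fun _ => 2 * (1 - α))) ?_ ?_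
  · rintro (i | i)
    · simp only [Sum.elim_inl]; nlinarith
    · simp only [Sum.elim_inr]; linarith
  · rintro (i | i)
    · simp [Finset.sum_filter, Fintype.sum_sum_type]
      nlinarith
    · simp [Finset.sum_filter, Fintype.sum_sum_type]
      ring

/-- The graph consisting of a vertex `u`, an edge `w₁ w₂`, and a set `N₁ ∪ N₂` of vertices of degree
two, those of `N₁` adjacent to `u` and `w₁`, those of `N₂` adjacent to `u` and `w₂`.
For `N₂` a single vertex this is `SK_{2,k}` with `k = |N₁| + 1`. -/
structure IsThetaFan {V : Type*} (G : SimpleGraph V) (u w₁ w₂ : V) (N₁ N₂ : Finset V) : Prop where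
  adj_u : ∀ x, G.Adj u x ↔ x ∈ N₁ ∨ x ∈ N₂
  adj_w₁ : ∀ x, G.Adj w₁ x ↔ x = w₂ ∨ x ∈ N₁
  adj_w₂ : ∀ x, G.Adj w₂ x ↔ x = w₁ ∨ x ∈ N₂
  adj_N₁ : ∀ v ∈ N₁, ∀ x, G.Adj v x ↔ x = u ∨ x = w₁
  adj_N₂ : ∀ v ∈ N₂, ∀ x, G.Adj v x ↔ x = u ∨ x = w₂
  disj : Disjoint N₁ N₂
  u_ne_w₁ : u ≠ w₁
  u_ne_w₂ : u ≠ w₂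
  cover : ∀ x, x = u ∨ x = w₁ ∨ x = w₂ ∨ x ∈ N₁ ∨ x ∈ N₂

namespace IsThetaFan

variable {V : Type*} {G : SimpleGraph V} {u w₁ w₂ : V} {N₁ N₂ : Finset V}

theorem symm (h : IsThetaFan G u w₁ w₂ N₁ N₂) : IsThetaFan G u w₂ w₁ N₂ N₁ where
  adj_u x := (h.adj_u x).trans or_comm
  adj_w₁ := h.adj_w₂
  adj_w₂ := h.adj_w₁
  adj_N₁ := h.adj_N₂
  adj_N₂ := h.adj_N₁
  disj := h.disj.symm
  u_ne_w₁ := h.u_ne_w₂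
  u_ne_w₂ := h.u_ne_w₁
  cover x := by have := h.cover x; tauto

theorem w₁_ne_w₂ (h : IsThetaFan G u w₁ w₂ N₁ N₂) : w₁ ≠ w₂ :=
  G.ne_of_adj ((h.adj_w₁ w₂).2 (Or.inl rfl))

theorem u_notMem_N₁ (h : IsThetaFan G u w₁ w₂ N₁ N₂) : u ∉ N₁ :=
  fun hu => G.irrefl ((h.adj_u u).2 (Or.inl hu))

theorem w₁_notMem_N₁ (h : IsThetaFan G u w₁ w₂ N₁ N₂) : w₁ ∉ N₁ :=
  fun hu => G.irrefl ((h.adj_w₁ w₁).2 (Or.inr hu))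

theorem w₂_notMem_N₁ (h : IsThetaFan G u w₁ w₂ N₁ N₂) : w₂ ∉ N₁ := fun hw =>
  ((h.adj_w₂ u).1 ((h.adj_u w₂).2 (Or.inl hw)).symm).elim h.u_ne_w₁ h.symm.u_notMem_N₁

/-- A vector constant on `N₁` and on `N₂`, whose row sums compare in the relation `R` with `l` times
its entries as soon as this holds for one vertex of each of the five kinds. -/
theorem exists_vector [Fintype V] (h : IsThetaFan G u w₁ w₂ N₁ N₂) (R : ℝ → ℝ → Prop)
    {α l A B₁ B₂ b₁ b₂ : ℝ} (hA : 0 < A) (hB₁ : 0 < B₁) (hB₂ : 0 < B₂) (hb₁ : 0 < b₁) (hb₂ : 0 < b₂)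
    (hu : R (#N₁ * (α * A + (1 - α) * b₁) + #N₂ * (α * A + (1 - α) * b₂)) (l * A))
    (hw₁ : R (α * B₁ + (1 - α) * B₂ + #N₁ * (α * B₁ + (1 - α) * b₁)) (l * B₁))
    (hw₂ : R (α * B₂ + (1 - α) * B₁ + #N₂ * (α * B₂ + (1 - α) * b₂)) (l * B₂))
    (h₁ : R (α * b₁ + (1 - α) * A + (α * b₁ + (1 - α) * B₁)) (l * b₁))
    (h₂ : R (α * b₂ + (1 - α) * A + (α * b₂ + (1 - α) * B₂)) (l * b₂)) :
    ∃ y : V → ℝ, (∀ v, 0 < y v) ∧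
      ∀ v, R (∑ w with G.Adj v w, (α * y v + (1 - α) * y w)) (l * y v) := by
  let y : V → ℝ := fun x => if x ∈ N₁ then b₁ else if x ∈ N₂ then b₂ else if x = u then A else
    if x = w₁ then B₁ else B₂
  have yu : y u = A := by simp [y, h.u_notMem_N₁, h.symm.u_notMem_N₁]
  have yw₁ : y w₁ = B₁ := by simp [y, h.w₁_notMem_N₁, h.symm.w₂_notMem_N₁, h.u_ne_w₁.symm]
  have yw₂ : y w₂ = B₂ := by
    simp [y, h.w₂_notMem_N₁, h.symm.w₁_notMem_N₁, h.u_ne_w₂.symm, h.w₁_ne_w₂.symm]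
  have y₁ : ∀ x ∈ N₁, y x = b₁ := fun x hx => by simp [y, hx]
  have y₂ : ∀ x ∈ N₂, y x = b₂ := fun x hx => by
    simp [y, hx, Finset.disjoint_right.1 h.disj hx]
  have s₁ : ∀ c, ∑ w ∈ N₁, (α * c + (1 - α) * y w) = #N₁ * (α * c + (1 - α) * b₁) := fun c => by
    rw [Finset.sum_congr rfl fun x hx => by rw [y₁ x hx], Finset.sum_const, nsmul_eq_mul]
  have s₂ : ∀ c, ∑ w ∈ N₂, (α * c + (1 - α) * y w) = #N₂ * (α * c + (1 - α) * b₂) := fun c => by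
    rw [Finset.sum_congr rfl fun x hx => by rw [y₂ x hx], Finset.sum_const, nsmul_eq_mul]
  refine ⟨y, fun v => ?_, fun v => ?_⟩
  · simp only [y]; split_ifs <;> assumption
  · have cov := h.cover v
    rcases cov with rfl | rfl | rfl | hv | hv
    · have : ({w | G.Adj v w} : Finset V) = N₁ ∪ N₂ := by ext x; simp [h.adj_u]
      rwa [this, Finset.sum_union h.disj, s₁, s₂, yu]
    · have : ({w | G.Adj v w} : Finset V) = insert w₂ N₁ := by ext x; simp [h.adj_w₁]
      rwa [this, Finset.sum_insert h.w₂_notMem_N₁, s₁, yw₁, yw₂]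
    · have : ({w | G.Adj v w} : Finset V) = insert w₁ N₂ := by ext x; simp [h.adj_w₂]
      rwa [this, Finset.sum_insert h.symm.w₂_notMem_N₁, s₂, yw₁, yw₂]
    · have : ({w | G.Adj v w} : Finset V) = {u, w₁} := by ext x; simp [h.adj_N₁ v hv]
      rwa [this, Finset.sum_pair h.u_ne_w₁, y₁ v hv, yu, yw₁]
    · have : ({w | G.Adj v w} : Finset V) = {u, w₂} := by ext x; simp [h.adj_N₂ v hv]
      rwa [this, Finset.sum_pair h.u_ne_w₂, y₂ v hv, yu, yw₂]

/-- If both `N₁` and `N₂` have at least two vertices, the index stays below every `l` that exceeds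
the larger root of `(x - α k) (x - 2 α) = 2 (k - 1) (1 - α) ^ 2`. -/
theorem alphaIndex_lt [Fintype V] (h : IsThetaFan G u w₁ w₂ N₁ N₂) {α l : ℝ} (h0 : 1 / 2 ≤ α)
    (h1 : α < 1) {k : ℕ} (hk : #N₁ + #N₂ = k) (hN₁ : 2 ≤ #N₁) (hN₂ : 2 ≤ #N₂) (hl : α * k < l)
    (hl' : 2 * (k - 1) * (1 - α) ^ 2 < (l - α * k) * (l - 2 * α)) : alphaIndex α G < l := by
  have : Nonempty V := ⟨u⟩
  have hk' : (#N₁ : ℝ) + #N₂ = k := by exact_mod_cast hk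
  have hN₁' : (2 : ℝ) ≤ #N₁ := by exact_mod_cast hN₁
  have hN₂' : (2 : ℝ) ≤ #N₂ := by exact_mod_cast hN₂
  have hb : 0 < 1 - α := by linarith
  have hD : 0 < l - α * k := by linarith
  -- `ε` spends half of the slack in `hl'`, so that all rows are strict
  obtain ⟨ε, hε, hε'⟩ : ∃ ε : ℝ, 0 < ε ∧
      2 * (k - 1) * (1 - α) ^ 2 + 2 * (1 - α) * ε < (l - α * k) * (l - 2 * α) := by
    refine ⟨((l - α * k) * (l - 2 * α) - 2 * (k - 1) * (1 - α) ^ 2) / (4 * (1 - α)),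
      div_pos (by linarith) (by linarith), ?_⟩
    have : 2 * (1 - α) * (((l - α * k) * (l - 2 * α) - 2 * (k - 1) * (1 - α) ^ 2) / (4 * (1 - α)))
        = ((l - α * k) * (l - 2 * α) - 2 * (k - 1) * (1 - α) ^ 2) / 2 := by
      field_simp; ring
    rw [this]; linarith
  have hAB : 0 < (1 - α) * (k - 2) + ε := by nlinarith
  have hw : ∀ a b : ℝ, a + b = k → 2 ≤ b →
      α * ((1 - α) * (k - 2) + ε) + (1 - α) * ((1 - α) * (k - 2) + ε) +
        a * (α * ((1 - α) * (k - 2) + ε) + (1 - α) * (l - α * k)) <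
          l * ((1 - α) * (k - 2) + ε) := by
    intro a b hab hb2
    -- the coefficient `l - 1 - α a` of the entry at `w₁` is at least `l - α k`
    have e1 : 0 ≤ (l - 1 - α * a - (l - α * k)) * ((1 - α) * (k - 2) + ε) :=
      mul_nonneg (by nlinarith) hAB.le
    have e2 : 0 ≤ (1 - α) * (k - 2 - a) * (l - α * k) :=
      mul_nonneg (mul_nonneg hb.le (by linarith)) hD.le
    have e3 : 0 < (l - α * k) * ε := mul_pos hD hε
    nlinarith
  have hleaf : α * (l - α * k) + (1 - α) * ((1 - α) * k + ε) +
      (α * (l - α * k) + (1 - α) * ((1 - α) * (k - 2) + ε)) < l * (l - α * k) := by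
    nlinarith
  obtain ⟨y, hy, h⟩ := h.exists_vector (· < ·) (α := α) (l := l) (A := (1 - α) * k + ε)
    (B₁ := (1 - α) * (k - 2) + ε) (B₂ := (1 - α) * (k - 2) + ε) (b₁ := l - α * k)
    (b₂ := l - α * k) (by nlinarith) hAB hAB hD hD
    (by rw [← add_mul, hk']; nlinarith [mul_pos hD hε])
    (hw _ _ hk' hN₂') (hw _ _ ((add_comm _ _).trans hk') hN₁') hleaf hleaf
  exact alphaIndex_lt_of_forall_lt (by linarith) h1.le hy h

end IsThetaFan

theorem isThetaFan_SK2 (k : ℕ) (hk : 0 < k) :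
    IsThetaFan (SK2 k hk) (some (Sum.inl 1)) (some (Sum.inl 0)) none
      ((univ.erase (⟨0, hk⟩ : Fin k)).map (Function.Embedding.inr.trans Function.Embedding.some))
      {some (Sum.inr ⟨0, hk⟩)} where
  adj_u := by
    rintro (_ | x | x) <;> simp [SK2, subdivideEdge, em']
  adj_w₁ := by
    rintro (_ | x | x) <;> simp [SK2, subdivideEdge]
  adj_w₂ := by
    rintro (_ | x | x) <;> simp [SK2, subdivideEdge]
  adj_N₁ := by
    simp only [mem_map, mem_erase, Function.Embedding.trans_apply, Function.Embedding.inr_apply,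
      Function.Embedding.some_apply]
    rintro _ ⟨i, hi, rfl⟩ (_ | x | x)
    · simpa [SK2, subdivideEdge] using hi.1
    · fin_cases x <;> simp [SK2, subdivideEdge, hi.1]
    · simp [SK2, subdivideEdge]
  adj_N₂ := by
    simp only [mem_singleton]
    rintro _ rfl (_ | x | x)
    · simp [SK2, subdivideEdge]
    · fin_cases x <;> simp [SK2, subdivideEdge]
    · simp [SK2, subdivideEdge]
  disj := by simp
  u_ne_w₁ := by simp
  u_ne_w₂ := by simp
  cover := by
    rintro (_ | x | x)
    · simp
    · fin_cases x <;> simp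
    · simp [em']

/-- A fan in which `N₂` is a single vertex is `SK_{2,k}`. -/
theorem IsThetaFan.nonempty_iso_SK2 {V : Type*} {G : SimpleGraph V} {u w₁ w₂ : V} {N₁ N₂ : Finset V}
    (h : IsThetaFan G u w₁ w₂ N₁ N₂) {k : ℕ} (hk : 0 < k) (hN : #N₁ + #N₂ = k) (hN₂ : #N₂ = 1) :
    Nonempty (G ≃g SK2 k hk) := by
  obtain ⟨v₂, rfl⟩ := Finset.card_eq_one.1 hN₂
  have hcard : #(N₁ ∪ {v₂}) = k := by rw [Finset.card_union_of_disjoint h.disj, hN]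
  have hv₂ : v₂ ∈ N₁ ∪ {v₂} := by simp
  let e₀ : Fin k ≃ ↥(N₁ ∪ {v₂}) := (Finset.equivFinOfCardEq hcard).symm
  let e : Fin k ≃ ↥(N₁ ∪ {v₂}) := e₀.trans (Equiv.swap (e₀ ⟨0, hk⟩) ⟨v₂, hv₂⟩)
  have he0 : e ⟨0, hk⟩ = ⟨v₂, hv₂⟩ := by simp [e]
  have hv₂' : v₂ ∉ N₁ := by simpa using h.disj
  have he : ∀ i, i ≠ ⟨0, hk⟩ → (e i : V) ∈ N₁ := by
    intro i hi
    have h2 := (e i).2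
    rw [Finset.mem_union, Finset.mem_singleton] at h2
    refine h2.resolve_right fun h3 => hi (e.injective ?_)
    rw [he0]; exact Subtype.ext h3
  have hS := isThetaFan_SK2 k hk
  let f : Option (Fin 2 ⊕ Fin k) → V
    | none => w₂
    | some (Sum.inl 0) => w₁
    | some (Sum.inl 1) => u
    | some (Sum.inr i) => e i
  have hu : ∀ i, (e i : V) ≠ u := fun i hi => by
    have h2 := (e i).2
    rw [hi, Finset.mem_union] at h2
    exact h2.elim h.u_notMem_N₁ h.symm.u_notMem_N₁
  have hw₁ : ∀ i, (e i : V) ≠ w₁ := fun i hi => by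
    have h2 := (e i).2
    rw [hi, Finset.mem_union] at h2
    exact h2.elim h.w₁_notMem_N₁ h.symm.w₂_notMem_N₁
  have hw₂ : ∀ i, (e i : V) ≠ w₂ := fun i hi => by
    have h2 := (e i).2
    rw [hi, Finset.mem_union] at h2
    exact h2.elim h.w₂_notMem_N₁ h.symm.w₁_notMem_N₁
  have hinj : Function.Injective f := by
    have h12 := h.w₁_ne_w₂
    have hu1 := h.u_ne_w₁
    have hu2 := h.u_ne_w₂
    rintro (_ | x | x) (_ | y | y) hxy
    · rfl
    · fin_cases y <;> simp [f, h12.symm, hu2.symm] at hxy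
    · exact absurd hxy.symm (hw₂ y)
    · fin_cases x <;> simp [f, h12, hu2] at hxy
    · fin_cases x <;> fin_cases y <;> simp [f, hu1, hu1.symm] at hxy ⊢
    · fin_cases x
      · exact absurd hxy.symm (hw₁ y)
      · exact absurd hxy.symm (hu y)
    · exact absurd hxy (hw₂ x)
    · fin_cases y
      · exact absurd hxy (hw₁ x)
      · exact absurd hxy (hu x)
    · rw [e.injective (Subtype.ext hxy)]
  have hN₁ : ∀ i, (e i : V) ∈ N₁ ↔ i ≠ ⟨0, hk⟩ :=
    fun i => ⟨fun hi h0 => hv₂' (by rw [h0, he0] at hi; exact hi), he i⟩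
  have hfN₁ : ∀ x, f x ∈ N₁ ↔ x ∈ (univ.erase (⟨0, hk⟩ : Fin k)).map
      (Function.Embedding.inr.trans Function.Embedding.some) := by
    rintro (_ | x | x)
    · simp [f, h.w₂_notMem_N₁]
    · fin_cases x <;> simp [f, h.w₁_notMem_N₁, h.u_notMem_N₁]
    · simp [f, hN₁]
  have hfw₂ : ∀ x, f x = w₂ ↔ x = none := fun x => hinj.eq_iff (b := none)
  have hfw₁ : ∀ x, f x = w₁ ↔ x = some (Sum.inl 0) := fun x => hinj.eq_iff (b := some (Sum.inl 0))
  have hfu : ∀ x, f x = u ↔ x = some (Sum.inl 1) := fun x => hinj.eq_iff (b := some (Sum.inl 1))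
  have hfv₂ : ∀ x, f x ∈ ({v₂} : Finset V) ↔
      x ∈ ({some (Sum.inr ⟨0, hk⟩)} : Finset (Option (Fin 2 ⊕ Fin k))) := fun x => by
    rw [Finset.mem_singleton, Finset.mem_singleton, ← hinj.eq_iff (b := some (Sum.inr ⟨0, hk⟩))]
    simp only [f, he0]
  have hsurj : Function.Surjective f := by
    intro v
    rcases h.cover v with rfl | rfl | rfl | hv | hv
    · exact ⟨_, (hfu _).2 rfl⟩
    · exact ⟨_, (hfw₁ _).2 rfl⟩
    · exact ⟨_, (hfw₂ _).2 rfl⟩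
    · exact ⟨some (Sum.inr (e.symm ⟨v, Finset.mem_union_left _ hv⟩)), by simp [f]⟩
    · exact ⟨some (Sum.inr (e.symm ⟨v, Finset.mem_union_right _ hv⟩)), by simp [f]⟩
  refine ⟨(RelIso.mk (Equiv.ofBijective f (show Function.Bijective f from ⟨hinj, hsurj⟩))
      fun {x y} => ?_ :
    SK2 k hk ≃g G).symm⟩
  change G.Adj (f x) (f y) ↔ (SK2 k hk).Adj x y
  rcases hS.cover x with hx | hx | hx | hx | hx
  · rw [(hfu x).2 hx, hx, h.adj_u, hS.adj_u, hfN₁, hfv₂]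
  · rw [(hfw₁ x).2 hx, hx, h.adj_w₁, hS.adj_w₁, hfN₁, hfw₂]
  · rw [(hfw₂ x).2 hx, hx, h.adj_w₂, hS.adj_w₂, hfv₂, hfw₁]
  · rw [h.adj_N₁ _ ((hfN₁ x).2 hx), hS.adj_N₁ _ hx, hfu, hfw₁]
  · rw [h.adj_N₂ _ ((hfv₂ x).2 hx), hS.adj_N₂ _ hx, hfu, hfw₂]

/-- The index of `SK_{2,k}`, through an eigenvector constant on the orbits of its symmetries. -/
theorem alphaIndex_SK2_eq {α : ℝ} (h0 : 1 / 2 ≤ α) (h1 : α < 1) {k : ℕ} (hk : 4 ≤ k) {l : ℝ}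
    (hl : α * k < l) (hl' : (l - α * k) * (l - 2 * α) * (l - α - 1) =
      (1 - α) ^ 2 * (2 * (k - 1) * (l - α - 1) + (l - 2 * α))) :
    alphaIndex α (SK2 k (by omega)) = l := by
  have hk' : (4 : ℝ) ≤ k := by exact_mod_cast hk
  have hb : 0 < 1 - α := by linarith
  have hp : 0 < l - 2 * α := by nlinarith
  have hq : 0 < l - α - 1 := by nlinarith
  have hc : ((k - 1 : ℕ) : ℝ) = k - 1 := by rw [Nat.cast_sub (by omega)]; simp
  obtain ⟨y, hy, h⟩ := (isThetaFan_SK2 k (by omega)).exists_vector (· = ·) (α := α) (l := l)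
    (A := (l - 2 * α) * (l - α - 1)) (B₁ := (l - 2 * α) * (l - α - 1)) (B₂ := (1 - α) * (l - 2 * α))
    (b₁ := 2 * (1 - α) * (l - α - 1)) (b₂ := (1 - α) * (l - 2 * α)) (by positivity) (by positivity)
    (by positivity) (by positivity) (by positivity)
    (by simp [hc]; linear_combination -hl') (by simp [hc]; linear_combination -hl')
    (by simp; ring) (by ring) (by ring)
  exact alphaIndex_eq_of_forall_eq (by linarith) h1.le hy h

theorem skCubic_eq (k : ℕ) (α x : ℝ) : skCubic (2 * k + 1) α x =
    (x - α * k) * (x - 2 * α) * (x - α - 1) -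
      (1 - α) ^ 2 * (2 * (k - 1) * (x - α - 1) + (x - 2 * α)) := by
  simp only [skCubic]; push_cast; ring

/-- The index of `SK_{2,k}` is the largest root of the cubic. -/
theorem isGreatest_alphaIndex_SK2 {α : ℝ} (h0 : 1 / 2 ≤ α) (h1 : α < 1) {k : ℕ} (hk : 4 ≤ k) :
    ∃ l : ℝ, α * k < l ∧ (2 * k - 1) * (1 - α) ^ 2 < (l - α * k) * (l - 2 * α) ∧
      alphaIndex α (SK2 k (by omega)) = l ∧ IsGreatest {x | skCubic (2 * k + 1) α x = 0} l := by
  have hk' : (4 : ℝ) ≤ k := by exact_mod_cast hk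
  have hb : 0 < 1 - α := by linarith
  obtain ⟨l, ⟨hl1, hl2⟩, hl⟩ : (0 : ℝ) ∈
      (fun x : ℝ => skCubic (2 * k + 1) α x) '' Set.Icc (α * k) (α * k + 2 * k) := by
    refine intermediate_value_Icc (by linarith) (by unfold skCubic; fun_prop) ⟨?_, ?_⟩
    · simp only [skCubic_eq]
      have : 0 < (1 - α) ^ 2 * (2 * (k - 1) * (α * k - α - 1) + (α * k - 2 * α)) := by
        have h2 : 0 < α * k - α - 1 := by nlinarith
        have h3 : 0 < α * k - 2 * α := by nlinarith
        have h4 : (0 : ℝ) < k - 1 := by linarith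
        positivity
      linarith
    · simp only [skCubic_eq]
      have h2 : 0 < α * k + 2 * k - α - 1 := by nlinarith
      have h3 : 0 < α * k + 2 * k - 2 * α := by nlinarith
      have h4 : (1 - α) ^ 2 ≤ 1 := by nlinarith
      have h5 : 0 ≤ 2 * (k - 1) * (α * k + 2 * k - α - 1) + (α * k + 2 * k - 2 * α) := by
        have : (0 : ℝ) < k - 1 := by linarith
        positivity
      have h6 := mul_le_mul_of_nonneg_right h4 h5
      nlinarith [mul_pos h2 h3]
  simp only at hl
  have hl1' : α * k < l := by
    refine lt_of_le_of_ne hl1 fun h => ?_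
    rw [skCubic_eq, ← h, sub_self] at hl
    have h2 : 0 < α * k - α - 1 := by nlinarith
    have h3 : 0 < α * k - 2 * α := by nlinarith
    have h4 : (0 : ℝ) < k - 1 := by linarith
    have : 0 < (1 - α) ^ 2 * (2 * (k - 1) * (α * k - α - 1) + (α * k - 2 * α)) := by positivity
    linarith
  have hpos : ∀ x, l ≤ x → 0 < x - α * k ∧ 0 < x - 2 * α ∧ 0 < x - α - 1 := fun x hx =>
    ⟨by linarith, by nlinarith, by nlinarith⟩
  have hroot : ∀ x, skCubic (2 * k + 1) α x = 0 → (x - α * k) * (x - 2 * α) * (x - α - 1) =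
      (1 - α) ^ 2 * (2 * (k - 1) * (x - α - 1) + (x - 2 * α)) := fun x hx => by
    rw [skCubic_eq] at hx; linarith
  have heig : ∀ x, l ≤ x → skCubic (2 * k + 1) α x = 0 → alphaIndex α (SK2 k (by omega)) = x :=
    fun x hx h => alphaIndex_SK2_eq h0 h1 hk (by linarith) (hroot x h)
  refine ⟨l, hl1', ?_, heig l le_rfl hl, hl, fun x hx => ?_⟩
  · obtain ⟨p1, p2, p3⟩ := hpos l le_rfl
    have h2 := hroot l hl
    refine lt_of_mul_lt_mul_right (a := l - α - 1) ?_ p3.le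
    rw [h2]
    -- the two sides differ by `(1 - α) ^ 3`
    nlinarith [pow_pos hb 3]
  · rcases le_total x l with h | h
    · exact h
    -- a root beyond `l` would again be the index
    · exact ((heig x h hx).symm.trans (heig l le_rfl hl)).le

variable {V : Type*} {G : SimpleGraph V}

/-! ### Cuts in minimally `2`-connected graphs -/

/-- The vertex `c` together with the edge `x y` separates `S ∋ x` from the remaining
vertices, among which is `y`. -/
structure IsMixedCut (G : SimpleGraph V) (x y c : V) (S : Set V) : Prop where
  left_mem : x ∈ S
  right_notMem : y ∉ S
  sep_notMem : c ∉ S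
  sep_ne_right : c ≠ y
  eq_of_adj : ∀ a ∈ S, ∀ b ∉ S, b ≠ c → G.Adj a b → a = x ∧ b = y

theorem IsMixedCut.symm {x y c : V} {S : Set V} (h : IsMixedCut G x y c S) :
    IsMixedCut G y x c {v | v ∉ S ∧ v ≠ c} where
  left_mem := ⟨h.right_notMem, h.sep_ne_right.symm⟩
  right_notMem := fun hx => hx.1 h.left_mem
  sep_notMem := fun hc => hc.2 rfl
  sep_ne_right := fun hc => h.sep_notMem (hc ▸ h.left_mem)
  eq_of_adj := fun a ha b hb hbc hab => by
    have hbS : b ∈ S := by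
      by_contra hbS
      exact hb ⟨hbS, hbc⟩
    exact (h.eq_of_adj b hbS a ha.1 ha.2 hab.symm).symm

theorem IsMixedCut.sep_eq_of_triangle {x y z c : V} {S : Set V} (h : IsMixedCut G x y c S)
    (hxz : G.Adj x z) (hyz : G.Adj y z) : c = z := by
  by_contra hcz
  by_cases hz : z ∈ S
  · exact G.ne_of_adj hxz (h.eq_of_adj z hz y h.right_notMem h.sep_ne_right.symm hyz.symm).1.symm
  · exact G.ne_of_adj hyz (h.eq_of_adj x h.left_mem z hz (Ne.symm hcz) hxz).2.symm

variable [Fintype V]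

/-- In a `2`-connected graph, for `C` with at most one vertex, a set `T` that neither contains nor
misses all vertices outside `C` is left by an edge with both ends outside `C`. -/
theorem IsKConnected.exists_adj (h : IsKConnected 2 G) {C : Finset V} (hC : #C < 2) {T : Set V}
    {a b : V} (ha : a ∈ T) (haC : a ∉ C) (hb : b ∉ T) (hbC : b ∉ C) :
    ∃ x ∈ T, ∃ y ∉ T, x ∉ C ∧ y ∉ C ∧ G.Adj x y := by
  obtain ⟨p⟩ := (h.2 C hC).preconnected ⟨a, haC⟩ ⟨b, hbC⟩
  obtain ⟨d, -, h1, h2⟩ := p.exists_boundary_dart (Subtype.val ⁻¹' T) ha hb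
  exact ⟨d.fst, h1, d.snd, h2, d.fst.2, d.snd.2, d.adj⟩

theorem IsKConnected.exists_adj_of_ne (h : IsKConnected 2 G) (T : Set V) {a b : V} (c : V)
    (ha : a ∈ T) (hac : a ≠ c) (hb : b ∉ T) (hbc : b ≠ c) :
    ∃ x ∈ T, ∃ y ∉ T, x ≠ c ∧ y ≠ c ∧ G.Adj x y := by
  simpa using h.exists_adj (C := {c}) (by simp) ha (by simpa using hac) hb (by simpa using hbc)

theorem IsKConnected.exists_ne_ne (h : IsKConnected 2 G) (a b : V) : ∃ c, c ≠ a ∧ c ≠ b := by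
  have h2 : #({a, b} : Finset V) < #(univ : Finset V) :=
    (Finset.card_le_two).trans_lt (by simpa using h.1)
  obtain ⟨c, -, hc⟩ := Finset.exists_mem_notMem_of_card_lt_card h2
  exact ⟨c, by simpa using hc⟩

theorem IsKConnected.exists_adj_ne (h : IsKConnected 2 G) {v c : V} (hvc : v ≠ c) :
    ∃ w, G.Adj v w ∧ w ≠ c := by
  obtain ⟨b, hb1, hb2⟩ := h.exists_ne_ne v c
  obtain ⟨x, rfl, y, -, -, hy, hxy⟩ := h.exists_adj_of_ne {v} c rfl hvc hb1 hb2
  exact ⟨y, hxy, hy⟩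

theorem IsKConnected.two_le_degree (h : IsKConnected 2 G) (v : V) : 2 ≤ G.degree v := by
  obtain ⟨c, hc, -⟩ := h.exists_ne_ne v v
  obtain ⟨w, hw, -⟩ := h.exists_adj_ne hc.symm
  obtain ⟨w', hw', hne⟩ := h.exists_adj_ne (G.ne_of_adj hw)
  rw [← G.card_neighborFinset_eq_degree, ← Finset.card_pair hne]
  refine Finset.card_le_card fun z hz => ?_
  rw [Finset.mem_insert, Finset.mem_singleton] at hz
  rcases hz with rfl | rfl <;> simpa

/-- Deleting an edge of a minimally `2`-connected graph creates a cut vertex. -/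
theorem IsMinimallyKConnected.exists_isMixedCut (h : IsMinimallyKConnected 2 G) {x y : V}
    (hxy : G.Adj x y) : ∃ c S, IsMixedCut G x y c S := by
  -- it suffices to separate by a set `C` of at most one vertex
  suffices H : ∃ (C : Finset V) (S : Set V), #C < 2 ∧ x ∉ C ∧ y ∉ C ∧ x ∈ S ∧ y ∉ S ∧
      ∀ a ∈ S, a ∉ C → ∀ b ∉ S, b ∉ C → G.Adj a b → a = x ∧ b = y by
    obtain ⟨C, S, hC, hxC, hyC, hxS, hyS, hS⟩ := H
    obtain ⟨c, hc, hcx, hcy⟩ : ∃ c, C ⊆ {c} ∧ c ≠ x ∧ c ≠ y := by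
      rcases C.eq_empty_or_nonempty with rfl | ⟨c, hc⟩
      · obtain ⟨c, h1, h2⟩ := h.1.exists_ne_ne x y
        exact ⟨c, Finset.empty_subset _, h1, h2⟩
      · refine ⟨c, fun d hd => ?_, fun hh => hxC (hh ▸ hc), fun hh => hyC (hh ▸ hc)⟩
        rw [Finset.mem_singleton]
        exact Finset.card_le_one.1 (by omega) _ hd _ hc
    have hC' : ∀ v, v ≠ c → v ∉ C := fun v hv hvC => hv (Finset.mem_singleton.1 (hc hvC))
    refine ⟨c, S \ {c}, ⟨hxS, fun hh => hcx hh.symm⟩, fun hh => hyS hh.1, fun hh => hh.2 rfl, hcy,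
      fun a ha b hb hbc hab => hS a ha.1 (hC' a ha.2) b (fun hbS => hb ⟨hbS, hbc⟩) (hC' b hbc) hab⟩
  have hdel := h.2 s(x, y) hxy
  simp only [IsKConnected, not_and, not_forall] at hdel
  obtain ⟨C, hC, hconn⟩ := hdel h.1.1
  have hne : Nonempty {v : V | v ∉ C} := (h.1.2 C hC).nonempty
  rw [SimpleGraph.connected_iff, not_and_or, or_iff_left (not_not_intro hne)] at hconn
  simp only [SimpleGraph.Preconnected, not_forall] at hconn
  obtain ⟨a, b, hab⟩ := hconn
  let H := (G.deleteEdges {s(x, y)}).induce {v : V | v ∉ C}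
  let R : Set V := {v | ∃ hv : v ∉ C, H.Reachable a ⟨v, hv⟩}
  have haR : (a : V) ∈ R := ⟨a.2, SimpleGraph.Reachable.refl _⟩
  have hbR : (b : V) ∉ R := fun ⟨_, hb⟩ => hab hb
  have hR : ∀ p ∈ R, ∀ q ∉ R, q ∉ C → G.Adj p q → s(p, q) = s(x, y) := by
    rintro p ⟨hpC, hp⟩ q hq hqC hpq
    by_contra hne
    refine hq ⟨hqC, hp.trans (SimpleGraph.Adj.reachable ?_)⟩
    simp [H, SimpleGraph.deleteEdges_adj, hpq, hne]
  obtain ⟨p, hp, q, hq, hpC, hqC, hpq⟩ := h.1.exists_adj hC haR a.2 hbR b.2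
  rcases Sym2.eq_iff.1 (hR p hp q hq hqC hpq) with ⟨rfl, rfl⟩ | ⟨rfl, rfl⟩
  · refine ⟨C, R, hC, hpC, hqC, hp, hq, fun v hv _ w hw hwC hvw => ?_⟩
    rcases Sym2.eq_iff.1 (hR v hv w hw hwC hvw) with h2 | ⟨rfl, rfl⟩
    · exact h2
    · exact absurd hv hq
  · refine ⟨C, Rᶜ, hC, hqC, hpC, hq, fun hh => hh hp, fun v hv hvC w hw hwC hvw => ?_⟩
    rw [Set.notMem_compl_iff] at hw
    rcases Sym2.eq_iff.1 (hR w hw v hv hvC hvw.symm) with ⟨rfl, rfl⟩ | ⟨rfl, rfl⟩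
    · exact absurd hp hv
    · exact ⟨rfl, rfl⟩

/-- In a triangle, the side of `x` in the cut belonging to the edge `x y` consists of `x` only:
the cut belonging to `x z` would split it further into pieces that touch a single vertex. -/
theorem IsMinimallyKConnected.eq_of_mem_of_triangle (h : IsMinimallyKConnected 2 G) {x y z : V}
    (hxy : G.Adj x y) (hxz : G.Adj x z) (hyz : G.Adj y z) {S : Set V} (hS : IsMixedCut G x y z S)
    {v : V} (hv : v ∈ S) : v = x := by
  obtain ⟨c, S', hS'⟩ := h.exists_isMixedCut hxz
  obtain rfl := hS'.sep_eq_of_triangle hxy hyz.symm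
  by_contra hvx
  have hyx := (G.ne_of_adj hxy).symm
  have hyS := hS.right_notMem
  have hzS' := hS'.right_notMem
  by_cases hvS' : v ∈ S'
  · obtain ⟨p, hp, q, hq, hpx, hqx, hpq⟩ :=
      h.1.exists_adj_of_ne (S ∩ S') x ⟨hv, hvS'⟩ hvx (fun hh => hyS hh.1) hyx
    by_cases hqS : q ∈ S
    · exact hpx (hS'.eq_of_adj p hp.2 q (fun hh => hq ⟨hqS, hh⟩)
        (fun hh => hyS (hh ▸ hqS)) hpq).1
    · by_cases hqz : q = z
      · subst hqz
        exact hpx (hS'.eq_of_adj p hp.2 q hzS' (G.ne_of_adj hyz).symm hpq).1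
      · exact hpx (hS.eq_of_adj p hp.1 q hqS hqz hpq).1
  · obtain ⟨p, hp, q, hq, hpz, hqz, hpq⟩ :=
      h.1.exists_adj_of_ne (S \ S') z ⟨hv, hvS'⟩ (fun hh => hS.sep_notMem (hh ▸ hv))
        (fun hh => hyS hh.1) (G.ne_of_adj hyz)
    have hpy : p ≠ c := fun hh => hyS (hh ▸ hp.1)
    by_cases hqS : q ∈ S
    · have hqS' : q ∈ S' := by
        by_contra hh
        exact hq ⟨hqS, hh⟩
      exact hpz (hS'.eq_of_adj q hqS' p hp.2 hpy hpq.symm).2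
    · have := (hS.eq_of_adj p hp.1 q hqS hqz hpq).1
      exact hp.2 (this ▸ hS'.left_mem)

theorem IsMinimallyKConnected.not_adj_of_adj_adj (h : IsMinimallyKConnected 2 G)
    (hV : 3 < Fintype.card V) {x y z : V} (hxy : G.Adj x y) (hxz : G.Adj x z) : ¬ G.Adj y z := by
  intro hyz
  obtain ⟨c, S, hS⟩ := h.exists_isMixedCut hxy
  obtain rfl := hS.sep_eq_of_triangle hxz hyz
  have h2 : #({x, y, c} : Finset V) < #(univ : Finset V) :=
    (Finset.card_le_three).trans_lt (by simpa using hV)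
  obtain ⟨v, -, hv⟩ := Finset.exists_mem_notMem_of_card_lt_card h2
  simp only [Finset.mem_insert, Finset.mem_singleton, not_or] at hv
  by_cases hvS : v ∈ S
  · exact hv.1 (h.eq_of_mem_of_triangle hxy hxz hyz hS hvS)
  · exact hv.2.1 (h.eq_of_mem_of_triangle hxy.symm hyz hxz hS.symm ⟨hvS, hv.2.2⟩)

/-- If every edge meets the independent neighbourhood of `u`, and `u` has degree at least three,
then each neighbour `v` of `u` has degree two. The second neighbour is the vertex `c` of the cut
belonging to the edge `u v`: any other one would force `c` to be a neighbour of `u`, and then the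
edge `u c` would not belong to a cut. -/
theorem IsMinimallyKConnected.exists_adj_iff_of_forall_adj (h : IsMinimallyKConnected 2 G) {u : V}
    (hind : ∀ x y, G.Adj u x → G.Adj u y → ¬ G.Adj x y)
    (hcov : ∀ x y, G.Adj x y → G.Adj u x ∨ G.Adj u y) (hdeg : 3 ≤ G.degree u) {v : V}
    (hv : G.Adj u v) : ∃ w, w ≠ u ∧ ∀ x, G.Adj v x ↔ x = u ∨ x = w := by
  obtain ⟨c, S, hS⟩ := h.exists_isMixedCut hv
  have huS := hS.left_mem
  have hvS := hS.right_notMem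
  have hcv := hS.sep_ne_right
  have huc : u ≠ c := fun hh => hS.sep_notMem (hh ▸ huS)
  have hN : ∀ n, G.Adj u n → n ≠ v → n ≠ c → n ∈ S := fun n hn hnv hnc => by
    by_contra hh
    exact hnv (hS.eq_of_adj u huS n hh hnc hn).2
  have hout : ∀ x, G.Adj v x → x ≠ u → x ∉ S := fun x hx hxu hxS =>
    hxu (hS.eq_of_adj x hxS v hvS hcv.symm hx.symm).1
  -- a further neighbour of `v` lies beyond the cut, so all its neighbours are `v` and `c`
  have hnext : ∀ x, G.Adj v x → x ≠ u → x ≠ c → G.Adj u c ∧ G.Adj x c := by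
    intro x hx hxu hxc
    obtain ⟨w, hw, hwv⟩ := h.1.exists_adj_ne (G.ne_of_adj hx).symm
    have huw : G.Adj u w := (hcov x w hw).resolve_left fun hux => hind v x hv hux hx
    have hwS : w ∉ S := fun hwS =>
      G.ne_of_adj huw (hS.eq_of_adj w hwS x (hout x hx hxu) hxc hw.symm).1.symm
    have hwc : w = c := by
      by_contra hwc
      exact hwS (hN w huw hwv hwc)
    exact hwc ▸ ⟨huw, hw⟩
  by_cases hc : G.Adj u c
  · exfalso
    obtain ⟨w, hw, hwu⟩ := h.1.exists_adj_ne hv.ne.symm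
    have hwc : w ≠ c := fun hh => hind v c hv hc (hh ▸ hw)
    have hwS := hout w hw hwu
    have hwc' := (hnext w hw hwu hwc).2
    obtain ⟨c', S', hS'⟩ := h.exists_isMixedCut hc
    have huS' := hS'.left_mem
    have hcc' := hS'.sep_ne_right
    -- the path `u v w c` has to pass through `c'`
    have hc' : c' ∉ S := by
      intro hc'
      have h1 : v ≠ c' := fun hh => hvS (hh ▸ hc')
      have h2 : w ≠ c' := fun hh => hwS (hh ▸ hc')
      have hvS' : v ∈ S' := by
        by_contra hh
        exact hcv (hS'.eq_of_adj u huS' v hh h1 hv).2.symm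
      have hwS' : w ∈ S' := by
        by_contra hh
        exact hv.ne (hS'.eq_of_adj v hvS' w hh h2 hw).1.symm
      exact hwu (hS'.eq_of_adj w hwS' c hS'.right_notMem hcc'.symm hwc').1
    obtain ⟨n, hn, hnv, hnc⟩ : ∃ n, G.Adj u n ∧ n ≠ v ∧ n ≠ c := by
      have h2 : #({v, c} : Finset V) < #(G.neighborFinset u) := by
        rw [G.card_neighborFinset_eq_degree]
        exact (Finset.card_le_two).trans_lt hdeg
      obtain ⟨n, hn, hn'⟩ := Finset.exists_mem_notMem_of_card_lt_card h2
      refine ⟨n, by simpa using hn, by simpa using hn'⟩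
    have hnS := hN n hn hnv hnc
    -- hence `S` without `u` falls apart into two sets attached to `u` and to `c` only
    by_cases hnS' : n ∈ S'
    · obtain ⟨p, hp, q, hq, hpu, hqu, hpq⟩ :=
        h.1.exists_adj_of_ne (S ∩ S') u ⟨hnS, hnS'⟩ hn.ne.symm (fun hh => hvS hh.1) hv.ne.symm
      by_cases hqS : q ∈ S
      · exact hpu (hS'.eq_of_adj p hp.2 q (fun hh => hq ⟨hqS, hh⟩)
          (fun hh => hc' (hh ▸ hqS)) hpq).1
      · by_cases hqc : q = c
        · subst hqc
          exact hpu (hS'.eq_of_adj p hp.2 q hS'.right_notMem hcc'.symm hpq).1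
        · exact hpu (hS.eq_of_adj p hp.1 q hqS hqc hpq).1
    · obtain ⟨p, hp, q, hq, hpc, hqc, hpq⟩ :=
        h.1.exists_adj_of_ne (S \ S') c ⟨hnS, hnS'⟩ hnc (fun hh => hvS hh.1) hcv.symm
      by_cases hqS : q ∈ S
      · have hqS' : q ∈ S' := by
          by_contra hh
          exact hq ⟨hqS, hh⟩
        exact hpc (hS'.eq_of_adj q hqS' p hp.2 (fun hh => hc' (hh ▸ hp.1)) hpq.symm).2
      · have := (hS.eq_of_adj p hp.1 q hqS hqc hpq).1
        exact hp.2 (this ▸ huS')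
  · have hsub : ∀ x, G.Adj v x → x ≠ u → x = c := fun x hx hxu => by
      by_contra hxc
      exact hc (hnext x hx hxu hxc).1
    refine ⟨c, huc.symm, fun x => ⟨fun hx => ?_, ?_⟩⟩
    · exact or_iff_not_imp_left.2 (hsub x hx)
    · rintro (rfl | rfl)
      · exact hv.symm
      · obtain ⟨w, hw, hwu⟩ := h.1.exists_adj_ne hv.ne.symm
        exact hsub w hw hwu ▸ hw

theorem card_filter_adj (G : SimpleGraph V) (u : V) : #{w | G.Adj u w} = G.degree u := by
  rw [← G.card_neighborFinset_eq_degree, SimpleGraph.neighborFinset_eq_filter]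

/-! ### Graphs with a dominating neighbourhood -/

/-- The degree sum over an independent neighbourhood counts the edges that meet it. -/
theorem card_filter_edgeFinset_eq_sum_degree {u : V}
    (hind : ∀ x y, G.Adj u x → G.Adj u y → ¬ G.Adj x y) :
    #{e ∈ G.edgeFinset | ∃ v ∈ e, G.Adj u v} = ∑ w with G.Adj u w, G.degree w := by
  have h1 : ({e ∈ G.edgeFinset | ∃ v ∈ e, G.Adj u v} : Finset (Sym2 V)) =
      ({w | G.Adj u w} : Finset V).biUnion fun w => G.incidenceFinset w := by
    ext e
    simp only [Finset.mem_filter, SimpleGraph.mem_edgeFinset, Finset.mem_biUnion, Finset.mem_univ,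
      true_and, SimpleGraph.mem_incidenceFinset, SimpleGraph.incidenceSet, Set.mem_sep_iff]
    constructor
    · rintro ⟨he, v, hve, hv⟩
      exact ⟨v, hv, he, hve⟩
    · rintro ⟨v, hv, he, hve⟩
      exact ⟨he, v, hve, hv⟩
  rw [h1, Finset.card_biUnion]
  · simp only [SimpleGraph.card_incidenceFinset_eq_degree]
  · intro x hx y hy hxy
    refine Finset.disjoint_left.2 fun e hex hey => ?_
    rw [SimpleGraph.mem_incidenceFinset] at hex hey
    exact hind x y (Finset.mem_filter.1 hx).2 (Finset.mem_filter.1 hy).2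
      (SimpleGraph.adj_of_mem_incidenceSet G hxy hex hey)

theorem nonempty_iso_K2 {u w : V} (huw : u ≠ w) (hu : ¬ G.Adj u w)
    (hN : ∀ v, G.Adj u v → ∀ x, G.Adj v x ↔ x = u ∨ x = w)
    (hcov : ∀ x, x = u ∨ x = w ∨ G.Adj u x) : Nonempty (G ≃g K2 (G.degree u)) := by
  have hw : ∀ x, G.Adj w x ↔ G.Adj u x := fun x => by
    refine ⟨fun hx => ?_, fun hx => ((hN x hx w).2 (Or.inr rfl)).symm⟩
    rcases hcov x with rfl | rfl | h
    · exact absurd hx.symm hu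
    · exact absurd hx (G.irrefl)
    · exact h
  let e : Fin (G.degree u) ≃ ↥({x | G.Adj u x} : Finset V) :=
    (Finset.equivFinOfCardEq (card_filter_adj G u)).symm
  have he : ∀ i, G.Adj u (e i) := fun i => (Finset.mem_filter.1 (e i).2).2
  let f : Fin 2 ⊕ Fin (G.degree u) → V
    | Sum.inl 0 => u
    | Sum.inl 1 => w
    | Sum.inr i => e i
  have hu' : ∀ i, (e i : V) ≠ u := fun i => (he i).ne.symm
  have hw' : ∀ i, (e i : V) ≠ w := fun i hi => hu (hi ▸ he i)
  have hf : Function.Bijective f := by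
    constructor
    · rintro (x | x) (y | y) hxy
      · fin_cases x <;> fin_cases y <;> simp [f, huw, huw.symm] at hxy ⊢
      · fin_cases x
        · exact absurd hxy.symm (hu' y)
        · exact absurd hxy.symm (hw' y)
      · fin_cases y
        · exact absurd hxy (hu' x)
        · exact absurd hxy (hw' x)
      · rw [e.injective (Subtype.ext hxy)]
    · intro v
      rcases hcov v with rfl | rfl | hv
      · exact ⟨Sum.inl 0, rfl⟩
      · exact ⟨Sum.inl 1, rfl⟩
      · exact ⟨Sum.inr (e.symm ⟨v, by simpa using hv⟩), by simp [f]⟩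
  refine ⟨(RelIso.mk (Equiv.ofBijective f hf) fun {x y} => ?_ : K2 (G.degree u) ≃g G).symm⟩
  change G.Adj (f x) (f y) ↔ (K2 (G.degree u)).Adj x y
  rcases x with x | x <;> rcases y with y | y
  · fin_cases x <;> fin_cases y <;> simp [f, hu, hw]
  · fin_cases x
    · simpa [f] using he y
    · simpa [f, hw] using he y
  · fin_cases y
    · simpa [f] using (he x).symm
    · simpa [f, G.adj_comm _ w, hw] using he x
  · simp [f, hN _ (he x), hu', hw']

/-- A vertex of degree at least three whose neighbourhood meets all edges is one of the two hubs of
a `K_{2,k}`. -/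
theorem IsMinimallyKConnected.nonempty_iso_K2 (h : IsMinimallyKConnected 2 G) {u : V}
    (hind : ∀ x y, G.Adj u x → G.Adj u y → ¬ G.Adj x y)
    (hcov : ∀ x y, G.Adj x y → G.Adj u x ∨ G.Adj u y) (hdeg : 3 ≤ G.degree u) :
    Nonempty (G ≃g K2 (G.degree u)) ∧ ∀ v, G.Adj u v → G.degree v = 2 := by
  have hN := fun v => h.exists_adj_iff_of_forall_adj hind hcov hdeg (v := v)
  constructor
  · obtain ⟨c, hc, -⟩ := h.1.exists_ne_ne u u
    obtain ⟨v₀, hv₀, -⟩ := h.1.exists_adj_ne hc.symm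
    obtain ⟨w, hwu, hw⟩ := hN v₀ hv₀
    have huw : ¬ G.Adj u w := fun huw => hind v₀ w hv₀ huw ((hw w).2 (Or.inr rfl))
    -- `w` and its neighbours are attached to `u` only
    have key : ∀ x, x = u ∨ x = w ∨ (G.Adj u x ∧ G.Adj x w) := by
      intro x
      by_contra! hx
      obtain ⟨p, hp, q, hq, hpu, hqu, hpq⟩ := h.1.exists_adj_of_ne
        {y | y = w ∨ (G.Adj u y ∧ G.Adj y w)} u (Or.inl rfl) hwu (b := x)
        (fun hh => hh.elim hx.2.1 fun hh => hx.2.2 hh.1 hh.2) hx.1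
      rcases hp with rfl | ⟨hp1, hp2⟩
      · exact hq (Or.inr ⟨(hcov p q hpq).resolve_left huw, hpq.symm⟩)
      · obtain ⟨w', hw'u, hw'⟩ := hN p hp1
        have h1 := ((hw' w).1 hp2).resolve_left hwu
        have h2 := ((hw' q).1 hpq).resolve_left hqu
        exact hq (Or.inl (h2.trans h1.symm))
    refine AlphaIndex.nonempty_iso_K2 hwu.symm huw (fun v hv x => ?_)
      (fun x => (key x).imp_right (Or.imp_right And.left))
    obtain ⟨w', hw'u, hw'⟩ := hN v hv
    have hvw : G.Adj v w := by
      rcases key v with rfl | rfl | hh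
      · exact absurd hv G.irrefl
      · exact absurd hv huw
      · exact hh.2
    rw [hw', ((hw' w).1 hvw).resolve_left hwu]
  · intro v hv
    obtain ⟨w, hwu, hw⟩ := hN v hv
    rw [← card_filter_adj, ← Finset.card_pair hwu.symm]
    congr 1
    ext x
    simp [hw]

/-- At a vertex of degree at least three, the degrees of the neighbours add up to fewer than `m`,
except in `K_{2,m/2}`. -/
theorem IsMinimallyKConnected.sum_degree_lt_or (h : IsMinimallyKConnected 2 G)
    (hV : 3 < Fintype.card V) {u : V} (hdeg : 3 ≤ G.degree u) :
    ∑ w with G.Adj u w, G.degree w < #G.edgeFinset ∨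
      (#G.edgeFinset = 2 * G.degree u ∧ Nonempty (G ≃g K2 (G.degree u))) := by
  have hind : ∀ x y, G.Adj u x → G.Adj u y → ¬ G.Adj x y :=
    fun x y hx hy => h.not_adj_of_adj_adj hV hx hy
  rw [or_iff_not_imp_left, not_lt]
  intro hle
  have hsum := card_filter_edgeFinset_eq_sum_degree hind
  have heq := Finset.eq_of_subset_of_card_le
    (Finset.filter_subset (fun e => ∃ v ∈ e, G.Adj u v) G.edgeFinset) (by rw [hsum]; exact hle)
  have hcov : ∀ x y, G.Adj x y → G.Adj u x ∨ G.Adj u y := by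
    intro x y hxy
    have hmem : s(x, y) ∈ G.edgeFinset := by simpa using hxy
    rw [← heq] at hmem
    simpa using (Finset.mem_filter.1 hmem).2
  obtain ⟨hiso, h2⟩ := h.nonempty_iso_K2 hind hcov hdeg
  refine ⟨?_, hiso⟩
  rw [← heq, hsum, Finset.sum_congr rfl fun v hv => h2 v (by simpa using hv), Finset.sum_const,
    card_filter_adj, smul_eq_mul, mul_comm]

/-- If all neighbours of `u` have degree two and exactly one edge misses them, then that edge is the
edge `w₁ w₂` of a fan. -/
theorem IsMinimallyKConnected.exists_isThetaFan (h : IsMinimallyKConnected 2 G) {u : V}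
    (hind : ∀ x y, G.Adj u x → G.Adj u y → ¬ G.Adj x y) (h2 : ∀ v, G.Adj u v → G.degree v = 2)
    (hsum : (∑ w with G.Adj u w, G.degree w) + 1 = #G.edgeFinset) :
    ∃ w₁ w₂ N₁ N₂, IsThetaFan G u w₁ w₂ N₁ N₂ ∧ #N₁ + #N₂ = G.degree u ∧ 0 < #N₁ ∧ 0 < #N₂ := by
  have hcard : #{e ∈ G.edgeFinset | ¬ ∃ v ∈ e, G.Adj u v} = 1 := by
    have := Finset.card_filter_add_card_filter_not (s := G.edgeFinset)
      (fun e => ∃ v ∈ e, G.Adj u v)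
    rw [card_filter_edgeFinset_eq_sum_degree hind] at this
    omega
  obtain ⟨e, he⟩ := Finset.card_eq_one.1 hcard
  obtain ⟨w₁, w₂⟩ := e
  have hmem : ∀ x y, (G.Adj x y ∧ ¬ G.Adj u x ∧ ¬ G.Adj u y) ↔ s(x, y) = s(w₁, w₂) := by
    intro x y
    rw [← Finset.mem_singleton]
    refine Iff.trans ?_ (iff_of_eq (congrArg (s(x, y) ∈ ·) he))
    simp
  obtain ⟨hww, hw₁, hw₂⟩ := (hmem w₁ w₂).2 rfl
  have huw₁ : u ≠ w₁ := by rintro rfl; exact hw₂ hww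
  have huw₂ : u ≠ w₂ := by rintro rfl; exact hw₁ hww.symm
  have hdeg : ∀ v, G.Adj u v → ∀ w, G.Adj v w → w ≠ u → ∀ x, G.Adj v x ↔ x = u ∨ x = w := by
    intro v hv w hw hwu x
    have hsub : ({u, w} : Finset V) ⊆ G.neighborFinset v := by
      intro y hy
      rw [Finset.mem_insert, Finset.mem_singleton] at hy
      rcases hy with rfl | rfl
      · simpa using hv.symm
      · simpa using hw
    have heq := Finset.eq_of_subset_of_card_le hsub
      (by rw [G.card_neighborFinset_eq_degree, h2 v hv, Finset.card_pair hwu.symm])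
    rw [← G.mem_neighborFinset, ← heq, Finset.mem_insert, Finset.mem_singleton]
  have hnext : ∀ w w', G.Adj w w' → ¬ G.Adj u w → s(w, w') = s(w₁, w₂) ∨ G.Adj u w' :=
    fun w w' ha hw => or_iff_not_imp_right.2 fun hw' => (hmem w w').1 ⟨ha, hw, hw'⟩
  have hw₁x : ∀ x, G.Adj w₁ x → x = w₂ ∨ G.Adj u x := fun x hx =>
    (hnext w₁ x hx hw₁).imp_left fun hh => Sym2.congr_right.1 hh
  have hw₂x : ∀ x, G.Adj w₂ x → x = w₁ ∨ G.Adj u x := fun x hx =>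
    (hnext w₂ x hx hw₂).imp_left fun hh => Sym2.congr_right.1 (hh.trans Sym2.eq_swap)
  -- `w₁`, `w₂` and their neighbours are attached to `u` only
  have key : ∀ x, x = u ∨ x = w₁ ∨ x = w₂ ∨ (G.Adj u x ∧ G.Adj x w₁) ∨
      (G.Adj u x ∧ G.Adj x w₂) := by
    intro x
    by_contra hx
    rw [not_or] at hx
    obtain ⟨p, hp, q, hq, hpu, hqu, hpq⟩ := h.1.exists_adj_of_ne
      {x | x = w₁ ∨ x = w₂ ∨ (G.Adj u x ∧ G.Adj x w₁) ∨ (G.Adj u x ∧ G.Adj x w₂)} u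
      (Or.inl rfl) huw₁.symm (b := x) hx.2 hx.1
    rcases hp with rfl | rfl | ⟨hp1, hp2⟩ | ⟨hp1, hp2⟩
    · rcases hw₁x q hpq with hh | hh
      · exact hq (Or.inr (Or.inl hh))
      · exact hq (Or.inr (Or.inr (Or.inl ⟨hh, hpq.symm⟩)))
    · rcases hw₂x q hpq with hh | hh
      · exact hq (Or.inl hh)
      · exact hq (Or.inr (Or.inr (Or.inr ⟨hh, hpq.symm⟩)))
    · exact hq (Or.inl (((hdeg p hp1 _ hp2 huw₁.symm q).1 hpq).resolve_left hqu))
    · exact hq (Or.inr (Or.inl (((hdeg p hp1 _ hp2 huw₂.symm q).1 hpq).resolve_left hqu)))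
  have hfan : IsThetaFan G u w₁ w₂ {x | G.Adj u x ∧ G.Adj x w₁} {x | G.Adj u x ∧ G.Adj x w₂} := by
    refine ⟨fun x => ?_, fun x => ?_, fun x => ?_, fun v hv => ?_, fun v hv => ?_, ?_, huw₁, huw₂,
      fun x => by simpa using key x⟩
    · simp only [Finset.mem_filter, Finset.mem_univ, true_and]
      refine ⟨fun hx => ?_, fun hx => hx.elim And.left And.left⟩
      rcases key x with rfl | rfl | rfl | hh
      · exact absurd hx G.irrefl
      · exact absurd hx hw₁
      · exact absurd hx hw₂
      · exact hh
    · simp only [Finset.mem_filter, Finset.mem_univ, true_and]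
      refine ⟨fun hx => (hw₁x x hx).imp_right fun hh => ⟨hh, hx.symm⟩, ?_⟩
      rintro (rfl | hx)
      exacts [hww, hx.2.symm]
    · simp only [Finset.mem_filter, Finset.mem_univ, true_and]
      refine ⟨fun hx => (hw₂x x hx).imp_right fun hh => ⟨hh, hx.symm⟩, ?_⟩
      rintro (rfl | hx)
      exacts [hww.symm, hx.2.symm]
    · simp only [Finset.mem_filter, Finset.mem_univ, true_and] at hv
      exact hdeg v hv.1 _ hv.2 huw₁.symm
    · simp only [Finset.mem_filter, Finset.mem_univ, true_and] at hv
      exact hdeg v hv.1 _ hv.2 huw₂.symm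
    · rw [Finset.disjoint_left]
      intro v hv hv'
      simp only [Finset.mem_filter, Finset.mem_univ, true_and] at hv hv'
      rcases (hdeg v hv.1 _ hv.2 huw₁.symm w₂).1 hv'.2 with hh | hh
      · exact huw₂ hh.symm
      · exact hww.ne hh.symm
  refine ⟨w₁, w₂, _, _, hfan, ?_, ?_, ?_⟩
  · rw [← Finset.card_union_of_disjoint hfan.disj, ← card_filter_adj]
    congr 1
    ext x
    rw [Finset.mem_union, ← hfan.adj_u]
    simp
  · obtain ⟨x, hx, hne⟩ := h.1.exists_adj_ne hww.ne
    exact Finset.card_pos.2 ⟨x, ((hfan.adj_w₁ x).1 hx).resolve_left hne⟩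
  · obtain ⟨x, hx, hne⟩ := h.1.exists_adj_ne hww.ne.symm
    exact Finset.card_pos.2 ⟨x, ((hfan.adj_w₂ x).1 hx).resolve_left hne⟩

/-! ### The comparison of indices -/

/-- With `k = K + 1`, the bound `α K + (1 - α) (2 k) / K` for graphs of maximum degree below `k` lies
below every `l > α k` satisfying `(2 k - 1) (1 - α) ^ 2 < (l - α k) (l - 2 α)`. -/
theorem mul_add_mul_div_lt {α l : ℝ} (h0 : 1 / 2 ≤ α) (h1 : α < 1) {K : ℕ} (hK : 3 ≤ K)
    (hl : α * (K + 1) < l)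
    (hl' : (2 * K + 1) * (1 - α) ^ 2 < (l - α * (K + 1)) * (l - 2 * α)) :
    α * K + (1 - α) * ((2 * K + 2) / K) < l := by
  have hK' : (3 : ℝ) ≤ K := by exact_mod_cast hK
  by_contra! hle
  obtain ⟨r, hr⟩ : ∃ r : ℝ, r = (K + 1) / K := ⟨_, rfl⟩
  have hr2 : r ^ 2 * (K + 1) ≤ 2 * K + 2 := by
    have h2 : r ^ 2 ≤ 2 := by
      rw [hr, div_pow, div_le_iff₀ (by positivity)]; nlinarith
    nlinarith
  have hx : α * K + (1 - α) * ((2 * K + 2) / K) = α * K + 2 * (r * (1 - α)) := by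
    rw [hr]; ring
  rw [hx] at hle
  have hmono : (l - α * (K + 1)) * (l - 2 * α) ≤
      (2 * (r * (1 - α)) - α) * (2 * (r * (1 - α)) + α * (K - 2)) :=
    mul_le_mul (by linarith) (by linarith) (by nlinarith) (by linarith)
  -- the arithmetic-geometric mean inequality for `r (1 - α)` and `α` removes the mixed term
  have hsq : 0 ≤ (r * (1 - α) - α) ^ 2 * (K - 3) := mul_nonneg (sq_nonneg _) (by linarith)
  have hα : (1 - α) ^ 2 ≤ α ^ 2 := by nlinarith
  have hr3 := mul_le_mul_of_nonneg_right hr2 (sq_nonneg (1 - α))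
  nlinarith

/-- If no degree reaches `k`, the index stays below that of the extremal graphs. -/
theorem IsMinimallyKConnected.alphaIndex_lt (h : IsMinimallyKConnected 2 G) {α l : ℝ}
    (h0 : 1 / 2 ≤ α) (h1 : α < 1) {k : ℕ} (hk : 3 ≤ k) (hdeg : ∀ v, G.degree v < k)
    (hsum : ∀ v, 3 ≤ G.degree v → ∑ w with G.Adj v w, G.degree w ≤ 2 * k) (hl : α * k < l)
    (hl' : (2 * k - 1) * (1 - α) ^ 2 < (l - α * k) * (l - 2 * α)) : alphaIndex α G < l := by
  have : Nonempty V := Fintype.card_pos_iff.1 (by have := h.1.1; omega)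
  have htwo := h.1.two_le_degree
  have hsum2 : ∀ v, G.degree v = 2 → ∑ w with G.Adj v w, G.degree w ≤ 2 * (k - 1) := by
    intro v hv
    rw [← hv, ← card_filter_adj G v, ← smul_eq_mul]
    exact Finset.sum_le_card_nsmul _ _ _ fun w _ => by have := hdeg w; omega
  rcases hk.eq_or_lt with rfl | hk4
  -- for `k = 3` all degrees equal two
  · refine alphaIndex_lt_of_degree_le h0 h1.le (K := 2) (M := 4) (by norm_num)
      (fun v => by have := htwo v; omega) (fun v => by have := hdeg v; omega)
      (fun v => hsum2 v (by have := htwo v; have := hdeg v; omega)) ?_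
    push_cast at hl hl' ⊢
    by_contra! hle
    have hmono : (l - α * 3) * (l - 2 * α) ≤ (2 - α * 3) * (2 - 2 * α) :=
      mul_le_mul (by linarith) (by linarith) (by linarith) (by linarith)
    nlinarith
  · obtain ⟨K, rfl⟩ : ∃ K, k = K + 1 := ⟨k - 1, by omega⟩
    refine alphaIndex_lt_of_degree_le h0 h1.le (K := K) (M := 2 * K + 2) (by omega)
      (fun v => by have := htwo v; omega) (fun v => by have := hdeg v; omega) (fun v => ?_) ?_
    · rcases (htwo v).eq_or_lt with h2 | h2
      · have := hsum2 v h2.symm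
        omega
      · exact hsum v h2
    · push_cast at hl hl' ⊢
      exact mul_add_mul_div_lt h0 h1 (by omega) hl (by linarith)

theorem three_lt_card_of_card_edgeFinset (h : 6 ≤ #G.edgeFinset) : 3 < Fintype.card V := by
  by_contra! hV
  have h2 := h.trans G.card_edgeFinset_le_card_choose_two
  have h3 := Nat.choose_le_choose 2 hV
  have : Nat.choose 3 2 = 3 := rfl
  omega

theorem IsMinimallyKConnected.two_mul_degree_le (h : IsMinimallyKConnected 2 G) (u : V) :
    2 * G.degree u ≤ ∑ w with G.Adj u w, G.degree w := by
  rw [← card_filter_adj G u, mul_comm, ← smul_eq_mul]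
  exact Finset.card_nsmul_le_sum _ _ _ fun w _ => h.1.two_le_degree w

theorem IsMinimallyKConnected.alphaIndex_lt_or_iso_K2 (h : IsMinimallyKConnected 2 G) {α : ℝ}
    (h0 : 1 / 2 ≤ α) (h1 : α < 1) {k : ℕ} (hk : 3 ≤ k) (hm : #G.edgeFinset = 2 * k) :
    alphaIndex α G < alphaIndex α (K2 k) ∨ Nonempty (G ≃g K2 k) := by
  have hV : 3 < Fintype.card V := three_lt_card_of_card_edgeFinset (G := G) (by omega)
  rw [or_iff_not_imp_right]
  intro hiso
  have hsum : ∀ v, 3 ≤ G.degree v → ∑ w with G.Adj v w, G.degree w < 2 * k := by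
    intro v hv
    rcases h.sum_degree_lt_or hV hv with h2 | ⟨h2, h3⟩
    · rwa [← hm]
    · rw [show G.degree v = k by omega] at h3
      exact absurd h3 hiso
  obtain ⟨l, hl, hl', heq⟩ := exists_alphaIndex_K2_eq h0 h1 (k := k) (by omega)
  rw [heq]
  refine h.alphaIndex_lt h0 h1 hk (fun v => ?_) (fun v hv => (hsum v hv).le) hl ?_
  · by_contra! hv
    have := hsum v (by omega)
    have := h.two_mul_degree_le v
    omega
  · rw [hl']
    have : 0 < (1 - α) ^ 2 := pow_pos (by linarith) 2
    linarith

theorem IsMinimallyKConnected.alphaIndex_lt_or_iso_SK2 (h : IsMinimallyKConnected 2 G) {α : ℝ}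
    (h0 : 1 / 2 ≤ α) (h1 : α < 1) {k : ℕ} (hk : 4 ≤ k) (hm : #G.edgeFinset = 2 * k + 1) :
    alphaIndex α G < alphaIndex α (SK2 k (by omega)) ∨ Nonempty (G ≃g SK2 k (by omega)) := by
  have hV : 3 < Fintype.card V := three_lt_card_of_card_edgeFinset (G := G) (by omega)
  have hsum : ∀ v, 3 ≤ G.degree v → ∑ w with G.Adj v w, G.degree w ≤ 2 * k := by
    intro v hv
    rcases h.sum_degree_lt_or hV hv with h2 | ⟨h2, -⟩ <;> omega
  obtain ⟨l, hl, hl', heq, -⟩ := isGreatest_alphaIndex_SK2 h0 h1 hk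
  rw [heq]
  by_cases hdeg : ∀ v, G.degree v < k
  · exact Or.inl (h.alphaIndex_lt h0 h1 (by omega) hdeg hsum hl hl')
  push Not at hdeg
  obtain ⟨u, hu⟩ := hdeg
  have hle := hsum u (by omega)
  have hge := h.two_mul_degree_le u
  have hdu : G.degree u = k := by omega
  have h2 : ∀ v, G.Adj u v → G.degree v = 2 := by
    have hcongr : ∑ w with G.Adj u w, 2 = ∑ w with G.Adj u w, G.degree w := by
      rw [Finset.sum_const, card_filter_adj, smul_eq_mul]; omega
    intro v hv
    exact ((Finset.sum_eq_sum_iff_of_le fun w _ => h.1.two_le_degree w).1 hcongr v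
      (by simpa using hv)).symm
  obtain ⟨w₁, w₂, N₁, N₂, hfan, hN, hN₁, hN₂⟩ := h.exists_isThetaFan
    (fun x y hx hy => h.not_adj_of_adj_adj hV hx hy) h2 (by omega)
  rw [hdu] at hN
  by_cases hone₂ : #N₂ = 1
  · exact Or.inr (hfan.nonempty_iso_SK2 _ hN hone₂)
  by_cases hone₁ : #N₁ = 1
  · exact Or.inr (hfan.symm.nonempty_iso_SK2 _ (by omega) hone₁)
  have hb : 0 < (1 - α) ^ 2 := pow_pos (by linarith) 2
  exact Or.inl (hfan.alphaIndex_lt h0 h1 hN (by omega) (by omega) hl (by linarith))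

theorem le_and_eq_iff_of_lt_or_iso {W : Type*} [Fintype W] {α : ℝ} {H : SimpleGraph W}
    (h : alphaIndex α G < alphaIndex α H ∨ Nonempty (G ≃g H)) :
    alphaIndex α G ≤ alphaIndex α H ∧
      (alphaIndex α G = alphaIndex α H ↔ Nonempty (G ≃g H)) :=
  ⟨h.elim le_of_lt fun ⟨f⟩ => (alphaIndex_congr α f).le,
    fun he => h.resolve_left he.not_lt, fun ⟨f⟩ => alphaIndex_congr α f⟩

theorem card_edgeFinset_eq_ncard (G : SimpleGraph V) : #G.edgeFinset = G.edgeSet.ncard := by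
  rw [Set.ncard_eq_toFinset_card']
  congr 1

end AlphaIndex

theorem theorem1p4 (m : ℕ) (α : ℝ) (hα : α ∈ Set.Ico (1 / 2 : ℝ) 1) :
    (6 ≤ m → Even m →
      ∀ (V : Type*) [Fintype V] (G : SimpleGraph V),
        AlphaIndex.IsMinimallyKConnected 2 G → G.edgeSet.ncard = m →
          AlphaIndex.alphaIndex α G ≤ AlphaIndex.alphaIndex α (AlphaIndex.K2 (m / 2)) ∧
          (AlphaIndex.alphaIndex α G = AlphaIndex.alphaIndex α (AlphaIndex.K2 (m / 2)) ↔
            Nonempty (G ≃g AlphaIndex.K2 (m / 2)))) ∧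
    (∀ (hm : 9 ≤ m), Odd m →
      IsGreatest {x : ℝ | AlphaIndex.skCubic m α x = 0}
        (AlphaIndex.alphaIndex α (AlphaIndex.SK2 ((m - 1) / 2) (by omega))) ∧
      ∀ (V : Type*) [Fintype V] (G : SimpleGraph V),
        AlphaIndex.IsMinimallyKConnected 2 G → G.edgeSet.ncard = m →
          AlphaIndex.alphaIndex α G ≤
            AlphaIndex.alphaIndex α (AlphaIndex.SK2 ((m - 1) / 2) (by omega)) ∧
          (AlphaIndex.alphaIndex α G =
              AlphaIndex.alphaIndex α (AlphaIndex.SK2 ((m - 1) / 2) (by omega)) ↔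
            Nonempty (G ≃g AlphaIndex.SK2 ((m - 1) / 2) (by omega)))) := by
  obtain ⟨h0, h1⟩ := hα
  refine ⟨fun hm heven V _ G hG hcard => ?_, fun hm hodd => ⟨?_, fun V _ G hG hcard => ?_⟩⟩
  · rw [← AlphaIndex.card_edgeFinset_eq_ncard] at hcard
    exact AlphaIndex.le_and_eq_iff_of_lt_or_iso
      (hG.alphaIndex_lt_or_iso_K2 h0 h1 (by omega) (by obtain ⟨k, rfl⟩ := heven; omega))
  · obtain ⟨l, -, -, heq, hl⟩ :=
      AlphaIndex.isGreatest_alphaIndex_SK2 h0 h1 (k := (m - 1) / 2) (by omega)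
    rw [heq]
    rwa [show 2 * ((m - 1) / 2) + 1 = m by obtain ⟨k, rfl⟩ := hodd; omega] at hl
  · rw [← AlphaIndex.card_edgeFinset_eq_ncard] at hcard
    exact AlphaIndex.le_and_eq_iff_of_lt_or_iso
      (hG.alphaIndex_lt_or_iso_SK2 h0 h1 (by omega) (by obtain ⟨k, rfl⟩ := hodd; omega))
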